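/- Let $Q$ be the generator of an irreducible continuous-time Markov chain $(X_t)_{t\ge 0}$, with right-continuous trajectories, on a finite set $E$ with $n=|E|$ elements, and let $\pi$ be its stationary distribution. Write $\mathbb P_x$ and $\mathbb P_\mu$ for the law of the chain started from $x\in E$ and from a probability distribution $\mu$ on $E$. For $\emptyset\ne A\subset E$ let $H_A=\inf\{t\ge 0: X_t\in A\}$, and for $\alpha>0$ let $$T_{\rm hit}(\alpha)=\sup\{\mathbb E_x[H_A] : x\in E,\ \emptyset\neq A\subset E,\ \pi(A)\ge\alpha\}.$$ A randomized stopping time is a random time $T$, almost surely finite, such that for every $t\ge 0$ the event $\{T\le t\}$ is measurable with respect to the $\sigma$-field generated by $(X_s)_{s\le t}$ and a random variable $U$ that is independent of the chain (here: uniform on $[0,1]$). Let $\mu_0$ be any probability distribution on $E$. Then there is a randomized stopping time $T$ such that $$\mathbb P_{\mu_0}(X_T=y)=\pi(y)\ \text{ for all } y\in E,\qquad \mathbb P_{\mu_0}(T>t)\le \epsilon+\frac{T_{\rm hit}(\epsilon)}{t}\ \text{ for all } \epsilon\in(0,1) \text{ and all } t>0.$$ Moreover, $T$ can be taken of the following form.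 For $\emptyset\ne S\subset E$ let $\rho_S(a)=\mathbb P_{\mu_0}(X_{H_S}=a)$. There are an enumeration $a_1,\dots,a_n$ of $E$ and numbers $p_1,\dots,p_n\in[0,1]$ with $\sum_k p_k=1$ such that, with $A_k=E\setminus\{a_j: j<k\}$ (so that $E=A_1\supset A_2\supset\dots\supset A_n\neq\emptyset$), for every $k$ the pair $(p_k,a_k)$ has minimal first coordinate among all pairs $(p,a)\in[0,1]\times A_k$ satisfying $$\sum_{i<k}p_i\,\rho_{A_i}(a)+p\,\rho_{A_k}(a)=\pi(a);$$ and $T=H_A$, where $A$ is a random set that is a function of $U$ alone (hence independent of the chain) with $\mathbb P(A=A_k)=p_k$ for $1\le k\le n$. -/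

import Mathlib

open MeasureTheory
open scoped NNReal ENNReal Matrix

/-- `Q` is the generator of a continuous-time Markov chain on the finite set `E`: the off-diagonal
entries `q(x,y)` are nonnegative and every row sums to zero. -/
structure IsGenerator {E : Type*} [Fintype E] (Q : Matrix E E ℝ) : Prop where
  rate_nonneg : ∀ x y, x ≠ y → 0 ≤ Q x y
  row_sum : ∀ x, ∑ y, Q x y = 0

/-- Irreducibility: any state can be reached from any other along jumps of positive rate. -/
def IrreducibleGenerator {E : Type*} (Q : Matrix E E ℝ) : Prop :=
  ∀ x y, Relation.ReflTransGen (fun a b => a ≠ b ∧ 0 < Q a b) x y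

/-- The transition matrix `p_t = exp (t Q)`, with entries `p_t(x,y)`. -/
noncomputable def transition {E : Type*} [Fintype E] [DecidableEq E] (Q : Matrix E E ℝ) (t : ℝ≥0) :
    Matrix E E ℝ :=
  NormedSpace.exp ((t : ℝ) • Q)

/-- `π` is a stationary distribution of the chain with generator `Q`. -/
structure IsStationaryDistribution {E : Type*} [Fintype E] [DecidableEq E] (Q : Matrix E E ℝ)
    (π : E → ℝ) : Prop where
  mem_simplex : π ∈ stdSimplex ℝ E
  invariant : ∀ t : ℝ≥0, π ᵥ* transition Q t = π

/-- The process `X`, under the probability measures `law x` (`x ∈ E`), is the continuous-time Markov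
chain with generator `Q`: it has right-continuous trajectories (for the discrete topology of `E`),
and `law x` makes it a Markov chain with transition probabilities `p_t` that starts from `x`. -/
structure IsMarkovChain {E Ω : Type*} [Fintype E] [DecidableEq E] [MeasurableSpace E]
    [MeasurableSpace Ω] (Q : Matrix E E ℝ) (X : ℝ≥0 → Ω → E) (law : E → Measure Ω) : Prop where
  isProbabilityMeasure : ∀ x, IsProbabilityMeasure (law x)
  measurable : ∀ t, Measurable (X t)
  rightContinuous : ∀ (ω : Ω) (t : ℝ≥0), ∃ δ > (0 : ℝ≥0),
    ∀ s : ℝ≥0, t ≤ s → s < t + δ → X s ω = X t ω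
  finiteDimensional : ∀ (x : E) (n : ℕ) (t : Fin (n + 1) → ℝ≥0), Monotone t →
    ∀ y : Fin (n + 1) → E, law x {ω | ∀ i, X (t i) ω = y i} =
      ENNReal.ofReal (transition Q (t 0) x (y 0) *
        ∏ i : Fin n, transition Q (t i.succ - t i.castSucc) (y i.castSucc) (y i.succ))

/-- The law `∑ x, μ(x) law x` of the chain started from the distribution `μ`. -/
noncomputable def startedFrom {E Ω : Type*} [Fintype E] [MeasurableSpace Ω] (law : E → Measure Ω)
    (μ : E → ℝ) : Measure Ω :=
  ∑ x, ENNReal.ofReal (μ x) • law x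

/-- The hitting time `H_A = inf {t ≥ 0 : X_t ∈ A}`, equal to `∞` if `A` is never hit. -/
noncomputable def hitTime {E Ω : Type*} (X : ℝ≥0 → Ω → E) (A : Set E) : Ω → ℝ≥0∞ :=
  hittingAfter X A 0

/-- `T_hit(α)`, the supremum of `𝔼_x[H_A]` over the starting states `x` and the nonempty sets `A`
with `π(A) ≥ α`. -/
noncomputable def tHit {E Ω : Type*} [MeasurableSpace Ω] (X : ℝ≥0 → Ω → E) (law : E → Measure Ω)
    (π : E → ℝ) (α : ℝ) : ℝ≥0∞ :=
  ⨆ (x : E) (A : Finset E) (_ : A.Nonempty) (_ : α ≤ ∑ a ∈ A, π a),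
    ∫⁻ ω, hitTime X (A : Set E) ω ∂(law x)

/-- The harmonic measure `ρ_S(a)` on the set `S`, the probability under `P` that the chain hits
`S` and is at `a` when this happens first. -/
noncomputable def harmonicMeasure {E Ω : Type*} [MeasurableSpace Ω] (X : ℝ≥0 → Ω → E)
    (P : Measure Ω) (S : Set E) (a : E) : ℝ :=
  P.real {ω | ∃ s : ℝ≥0, hitTime X S ω = s ∧ X s ω = a}

/-- The filtration `t ↦ σ(X_s, s ≤ t; U)`, where `U` is the second coordinate of `Ω × [0,1]`. Under
a product measure `P ⊗ Lebesgue` the variable `U` is uniform on `[0,1]` and independent of `X`. -/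
def randomizedHistory {E Ω : Type*} [MeasurableSpace E] [mΩ : MeasurableSpace Ω]
    (X : ℝ≥0 → Ω → E) (hX : ∀ t, Measurable (X t)) :
    Filtration ℝ≥0 (inferInstance : MeasurableSpace (Ω × unitInterval)) where
  seq t := (⨆ s : ℝ≥0, ⨆ _ : s ≤ t,
      MeasurableSpace.comap (fun z : Ω × unitInterval => X s z.1) inferInstance) ⊔
    MeasurableSpace.comap (fun z : Ω × unitInterval => z.2) inferInstance
  mono' := by
    intro s t hst
    refine sup_le_sup_right ?_ _
    exact iSup₂_le fun r hr => le_iSup₂_of_le r (le_trans hr hst) le_rfl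
  le' := by
    intro t
    refine sup_le (iSup₂_le fun r _ => ?_) ?_
    · exact Measurable.comap_le ((hX r).comp measurable_fst)
    · exact Measurable.comap_le measurable_snd

/-- `T` is a randomized stopping time for the chain `X` started with law `P`: it is a stopping time
for the history of `X` and an independent uniform variable `U`, and it is finite almost surely. -/
structure IsRandomizedStoppingTime {E Ω : Type*} [MeasurableSpace E] [MeasurableSpace Ω]
    (X : ℝ≥0 → Ω → E) (hX : ∀ t, Measurable (X t)) (P : Measure Ω)
    (T : Ω × unitInterval → ℝ≥0∞) : Prop where
  isStoppingTime : IsStoppingTime (randomizedHistory X hX) T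
  ae_finite : ∀ᵐ z ∂(P.prod (volume : Measure unitInterval)), T z ≠ ∞

/-- The set `A_k = E \ {a_j : j < k}` that belongs to an enumeration `a` of `E`. -/
def tailSet {E : Type*} {n : ℕ} (a : Fin n ≃ E) (k : Fin n) : Set E :=
  {x | ∀ j < k, x ≠ a j}

/-- The inductive choice of the pairs `(p_k, a_k)` through the harmonic measures `ρ_{A_i}` of the
chain with law `P`: among all `(q, b) ∈ [0,1] × A_k` with
`∑_{i<k} p_i ρ_{A_i}(b) + q ρ_{A_k}(b) = π(b)`, the pair `(p_k, a_k)` is one whose first coordinate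
is minimal. -/
structure IsInductiveChoice {E Ω : Type*} [MeasurableSpace Ω] (X : ℝ≥0 → Ω → E) (P : Measure Ω)
    (π : E → ℝ) {n : ℕ} (a : Fin n ≃ E) (p : Fin n → ℝ) : Prop where
  mem_Icc : ∀ k, p k ∈ Set.Icc (0 : ℝ) 1
  balance : ∀ k, ∑ i ∈ Finset.Iio k, p i * harmonicMeasure X P (tailSet a i) (a k) +
    p k * harmonicMeasure X P (tailSet a k) (a k) = π (a k)
  minimal : ∀ k, ∀ q ∈ Set.Icc (0 : ℝ) 1, ∀ b ∈ tailSet a k,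
    ∑ i ∈ Finset.Iio k, p i * harmonicMeasure X P (tailSet a i) b +
      q * harmonicMeasure X P (tailSet a k) b = π b → p k ≤ q

/-! Pour mass onto E along the harmonic measures: along ρ_{A_1} until some state a_1 holds exactly
π(a_1), then delete that state and continue along ρ_{A_2}, and so on. Stopping at the first state to
fill prevents overflow, and a deleted state receives nothing more because ρ_{A_k} lives on A_k.
After n rounds every state is full, that is, ∑ p_k ρ_{A_k} = π (`exists_filling`). Each ρ_{A_k} has
mass one because an irreducible chain almost surely hits every nonempty set
(`IsMarkovChain.ae_hitTime_ne_top`). Hence ∑ p_k = 1, and stopping at H_A, with A = A_k with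
probability p_k independently of the chain, gives the law π.

For the tail, Markov's inequality handles the indices with π(A_k) ≥ ε
(`IsMarkovChain.startedFrom_hitTime_gt_le`). If m is the first index with π(A_m) < ε, every round
from m on pours only into A_m, which ends up holding π(A_m); so the remaining rates sum to at most ε
(`sum_rate_small_tail_le`). -/

/-! ### Hitting times of right-continuous paths -/

section HittingTimes

variable {E Ω : Type*} {X : ℝ≥0 → Ω → E} {A : Set E} {ω : Ω} {s t : ℝ≥0}

lemma hitTime_eq_top_iff : hitTime X A ω = ∞ ↔ ∀ s, X s ω ∉ A := by
  refine (hittingAfter_eq_top_iff (u := X) (s := A) (n := 0) (ω := ω)).trans ?_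
  simp

lemma hitTime_lt_iff : hitTime X A ω < t ↔ ∃ s < t, X s ω ∈ A := by
  refine (hittingAfter_lt_iff (u := X) (s := A) (n := 0) (ω := ω) (i := t)).trans ?_
  simp

lemma hitTime_le_of_mem (h : X s ω ∈ A) : hitTime X A ω ≤ s :=
  hittingAfter_le_of_mem (zero_le) h

/-- The trajectories of `X` are right-continuous for the discrete topology of `E`. -/
def HasRightContinuousPaths (X : ℝ≥0 → Ω → E) : Prop :=
  ∀ (ω : Ω) (t : ℝ≥0), ∃ δ > (0 : ℝ≥0), ∀ s : ℝ≥0, t ≤ s → s < t + δ → X s ω = X t ω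

/-- The infimum is attained: visits to A occur at or arbitrarily soon after s, while the path is
constant on some [s, s + δ). -/
lemma mem_of_hitTime_eq (hr : HasRightContinuousPaths X) (h : hitTime X A ω = s) :
    X s ω ∈ A := by
  obtain ⟨δ, hδ, hc⟩ := hr ω s
  obtain ⟨j, hj, hjA⟩ := hitTime_lt_iff.1
    (show hitTime X A ω < ((s + δ : ℝ≥0) : ℝ≥0∞) by
      rw [h]; exact_mod_cast lt_add_of_pos_right s hδ)
  have hsj : s ≤ j := by
    have := hitTime_le_of_mem hjA
    rw [h] at this
    exact_mod_cast this
  rwa [← hc j hsj hj]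

lemma hitTime_le_iff (hr : HasRightContinuousPaths X) :
    hitTime X A ω ≤ t ↔ ∃ s ≤ t, X s ω ∈ A := by
  refine ⟨fun h => ?_, fun ⟨s, hs, hA⟩ => (hitTime_le_of_mem hA).trans (by exact_mod_cast hs)⟩
  have hne : hitTime X A ω ≠ ∞ := ne_top_of_le_ne_top ENNReal.coe_ne_top h
  lift hitTime X A ω to ℝ≥0 using hne with s hs
  exact ⟨s, by exact_mod_cast h, mem_of_hitTime_eq hr hs.symm⟩

lemma exists_denseSeq_mem (hr : HasRightContinuousPaths X) (hst : s < t) (hA : X s ω ∈ A) :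
    ∃ i : ℕ, TopologicalSpace.denseSeq ℝ≥0 i < t ∧ X (TopologicalSpace.denseSeq ℝ≥0 i) ω ∈ A := by
  obtain ⟨δ, hδ, hc⟩ := hr ω s
  obtain ⟨_, ⟨i, rfl⟩, h1, h2⟩ := (TopologicalSpace.denseRange_denseSeq ℝ≥0).exists_between
    (lt_min hst (lt_add_of_pos_right s hδ))
  refine ⟨i, h2.trans_le (min_le_left _ _), ?_⟩
  rwa [hc _ h1.le (h2.trans_le (min_le_right _ _))]

/-- A visit before t lasts long enough to be seen at a dense time; a visit at t itself may not be,
so t is added. Only times up to t occur, as the stopping-time property requires. -/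
lemma setOf_hitTime_le_eq (hr : HasRightContinuousPaths X) :
    {ω | hitTime X A ω ≤ t} = X t ⁻¹' A ∪ ⋃ (i : ℕ) (_ : TopologicalSpace.denseSeq ℝ≥0 i ≤ t),
      X (TopologicalSpace.denseSeq ℝ≥0 i) ⁻¹' A := by
  ext ω
  simp only [Set.mem_ofPred_eq, hitTime_le_iff hr, Set.mem_union, Set.mem_preimage, Set.mem_iUnion,
    exists_prop]
  constructor
  · rintro ⟨s, hs, hA⟩
    rcases hs.eq_or_lt with rfl | hlt
    · exact Or.inl hA
    · obtain ⟨i, hi, hiA⟩ := exists_denseSeq_mem hr hlt hA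
      exact Or.inr ⟨i, hi.le, hiA⟩
  · rintro (h | ⟨i, hi, hiA⟩)
    · exact ⟨t, le_rfl, h⟩
    · exact ⟨_, hi, hiA⟩

/-- By right-continuity, the state at a finite hitting time H is the common value of the path at all
dense times in some window (H, H + 1/(n+1)). This expresses the event by countable operations, hence
its measurability. -/
lemma setOf_hitTime_eq_and_eq (hr : HasRightContinuousPaths X) (a : E) :
    {ω | ∃ s : ℝ≥0, hitTime X A ω = s ∧ X s ω = a} = {ω | hitTime X A ω ≠ ∞} ∩
      ⋃ n : ℕ, ⋂ i : ℕ, {ω | hitTime X A ω < TopologicalSpace.denseSeq ℝ≥0 i ∧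
        (TopologicalSpace.denseSeq ℝ≥0 i : ℝ≥0∞) < hitTime X A ω + (n + 1 : ℝ≥0∞)⁻¹}ᶜ ∪
          X (TopologicalSpace.denseSeq ℝ≥0 i) ⁻¹' {a} := by
  ext ω
  simp only [Set.mem_ofPred_eq, Set.mem_inter_iff, Set.mem_iUnion, Set.mem_iInter, Set.mem_union,
    Set.mem_compl_iff, Set.mem_preimage, Set.mem_singleton_iff, ← imp_iff_not_or]
  constructor
  · rintro ⟨s, hs, rfl⟩
    obtain ⟨δ, hδ, hc⟩ := hr ω s
    obtain ⟨n, hn⟩ := ENNReal.exists_inv_nat_lt (ENNReal.coe_ne_zero.2 hδ.ne')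
    refine ⟨by simp [hs], n, fun i hi => hc _ ?_ ?_⟩
    · rw [hs] at hi
      exact_mod_cast hi.1.le
    · rw [hs] at hi
      have h : (n + 1 : ℝ≥0∞)⁻¹ ≤ δ :=
        (ENNReal.inv_le_inv.2 le_self_add).trans hn.le
      exact_mod_cast hi.2.trans_le (add_le_add_right h _)
  · rintro ⟨hne, n, hn⟩
    lift hitTime X A ω to ℝ≥0 using hne with s hs
    refine ⟨s, rfl, ?_⟩
    obtain ⟨δ, hδ, hc⟩ := hr ω s
    have hpos : (0 : ℝ≥0) < (n + 1 : ℝ≥0)⁻¹ := by positivity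
    obtain ⟨_, ⟨i, rfl⟩, h1, h2⟩ := (TopologicalSpace.denseRange_denseSeq ℝ≥0).exists_between
      (lt_min (lt_add_of_pos_right s hpos) (lt_add_of_pos_right s hδ))
    rw [← hc _ h1.le (h2.trans_le (min_le_right _ _))]
    refine hn i ⟨by exact_mod_cast h1, ?_⟩
    have h3 := h2.trans_le (min_le_left _ _)
    have h4 : (n + 1 : ℝ≥0∞)⁻¹ = ((n + 1 : ℝ≥0)⁻¹ : ℝ≥0) := by
      rw [ENNReal.coe_inv (by positivity)]; simp
    rw [h4]
    exact_mod_cast h3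

variable [MeasurableSpace Ω] [MeasurableSpace E]

lemma measurable_hitTime (hr : HasRightContinuousPaths X) (hm : ∀ t, Measurable (X t))
    (hA : MeasurableSet A) : Measurable (hitTime X A) := by
  refine measurable_of_Iic fun c => ?_
  induction c with
  | top => simp
  | coe c =>
    change MeasurableSet {ω | hitTime X A ω ≤ c}
    rw [setOf_hitTime_le_eq hr]
    exact (hm c hA).union (.iUnion fun i => .iUnion fun _ => hm _ hA)

lemma measurableSet_hitTime_eq_and_eq [MeasurableSingletonClass E]
    (hr : HasRightContinuousPaths X) (hm : ∀ t, Measurable (X t)) (hA : MeasurableSet A) (a : E) :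
    MeasurableSet {ω | ∃ s : ℝ≥0, hitTime X A ω = s ∧ X s ω = a} := by
  have hH := measurable_hitTime hr hm hA
  rw [setOf_hitTime_eq_and_eq hr]
  refine (hH (measurableSet_singleton ∞).compl).inter (.iUnion fun n => .iInter fun i => ?_)
  exact ((measurableSet_lt hH measurable_const).inter
    (measurableSet_lt measurable_const (hH.add measurable_const))).compl.union
      (hm _ (measurableSet_singleton a))

end HittingTimes

/-! ### Harmonic measures as probability distributions -/

section HarmonicMeasure

variable {E Ω : Type*} [MeasurableSpace Ω] {X : ℝ≥0 → Ω → E} {A : Set E} {P : Measure Ω}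

lemma harmonicMeasure_nonneg (a : E) : 0 ≤ harmonicMeasure X P A a := measureReal_nonneg

lemma harmonicMeasure_eq_zero (hr : HasRightContinuousPaths X) {a : E} (ha : a ∉ A) :
    harmonicMeasure X P A a = 0 := by
  have h : {ω | ∃ s : ℝ≥0, hitTime X A ω = s ∧ X s ω = a} = ∅ := by
    ext ω
    simp only [Set.mem_ofPred_eq, Set.mem_empty_iff_false, iff_false]
    rintro ⟨s, hs, rfl⟩
    exact ha (mem_of_hitTime_eq hr hs)
  simp [harmonicMeasure, h]

lemma sum_harmonicMeasure_eq_one [Fintype E] [MeasurableSpace E] [MeasurableSingletonClass E]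
    [IsProbabilityMeasure P] (hr : HasRightContinuousPaths X) (hm : ∀ t, Measurable (X t))
    (hfin : ∀ᵐ ω ∂P, hitTime X A ω ≠ ∞) : ∑ a, harmonicMeasure X P A a = 1 := by
  unfold harmonicMeasure
  rw [← measureReal_biUnion_finset]
  · rw [← probReal_univ (μ := P)]
    refine measureReal_congr (Filter.eventuallyEq_univ.2 ?_)
    filter_upwards [hfin] with ω hω
    lift hitTime X A ω to ℝ≥0 using hω with s hs
    exact Set.mem_biUnion (Finset.mem_univ (X s ω)) ⟨s, hs.symm, rfl⟩
  · intro a _ b _ hab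
    refine Set.disjoint_left.2 ?_
    rintro ω ⟨s, hs, rfl⟩ ⟨t, ht, rfl⟩
    have : s = t := by rw [hs] at ht; exact_mod_cast ht
    exact hab (by rw [this])
  · exact fun a _ => measurableSet_hitTime_eq_and_eq hr hm (Set.toFinite A).measurableSet a

end HarmonicMeasure

/-! ### The greedy filling of π -/

section Selection

variable {E : Type*} [Fintype E]

/-- One step of the filling construction: the next rate and state, chosen with minimal rate. -/
lemma exists_minimal_filling {ρ π σ : E → ℝ} {S : Set E} (hρ : ∀ a, 0 ≤ ρ a)
    (hρS : ∀ a ∉ S, ρ a = 0) (hρ1 : ∑ a, ρ a = 1) (hπ1 : ∑ a, π a = 1) (hσ : ∀ a, 0 ≤ σ a)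
    (hσπ : ∀ a, σ a ≤ π a) :
    ∃ q ∈ Set.Icc (0 : ℝ) 1, ∃ b ∈ S, σ b + q * ρ b = π b ∧ (∀ a, σ a + q * ρ a ≤ π a) ∧
      ∀ q' ∈ Set.Icc (0 : ℝ) 1, ∀ b' ∈ S, σ b' + q' * ρ b' = π b' → q ≤ q' := by
  classical
  -- A state of S that is already full allows the rate 0. Otherwise only states with ρ > 0 can
  -- become full, and the least ratio (π - σ)/ρ tells which one does so first.
  by_cases h0 : ∃ b ∈ S, σ b = π b
  · obtain ⟨b, hb, hbe⟩ := h0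
    exact ⟨0, by simp, b, hb, by simpa using hbe, by simpa using hσπ, fun q' hq' _ _ _ => hq'.1⟩
  push Not at h0
  have hne : (Finset.univ.filter fun a => 0 < ρ a).Nonempty := by
    by_contra h
    rw [Finset.not_nonempty_iff_eq_empty, Finset.filter_eq_empty_iff] at h
    have : ∑ a, ρ a = 0 :=
      Finset.sum_eq_zero fun a ha => le_antisymm (not_lt.1 (h ha)) (hρ a)
    linarith
  obtain ⟨b, hb, hmin⟩ := Finset.exists_min_image _ (fun a => (π a - σ a) / ρ a) hne
  rw [Finset.mem_filter] at hb
  have hbρ := hb.2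
  set q := (π b - σ b) / ρ b with hq
  have hq0 : 0 ≤ q := div_nonneg (sub_nonneg.2 (hσπ b)) hbρ.le
  have hle : ∀ a, σ a + q * ρ a ≤ π a := fun a => by
    rcases (hρ a).eq_or_lt with ha | ha
    · simpa [← ha] using hσπ a
    · have := hmin a (by simpa using ha)
      rw [le_div_iff₀ ha] at this
      linarith
  refine ⟨q, ⟨hq0, ?_⟩, b, ?_, ?_, hle, fun q' _ b' hb' he => ?_⟩
  -- The mass poured in this round fits under π, whose total is 1.
  · calc q = ∑ a, q * ρ a := by rw [← Finset.mul_sum, hρ1, mul_one]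
      _ ≤ ∑ a, π a := Finset.sum_le_sum fun a _ => by linarith [hle a, hσ a]
      _ = 1 := hπ1
  · by_contra h
    exact hbρ.ne' (hρS b h)
  · rw [hq, div_mul_cancel₀ _ hbρ.ne']
    ring
  · rcases (hρ b').eq_or_lt with hb0 | hb0
    · exact absurd (by simpa [← hb0] using he) (h0 b' hb')
    · have hs := hle b'
      rw [← he] at hs
      exact le_of_mul_le_mul_right (by linarith) hb0

/-- The iterated filling construction, as a sequence of states and rates. -/
lemma exists_filling_sequence {ρ : Set E → E → ℝ} {π : E → ℝ} (hρ : ∀ S a, 0 ≤ ρ S a)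
    (hρS : ∀ S, ∀ a ∉ S, ρ S a = 0) (hρ1 : ∀ S : Set E, S.Nonempty → ∑ a, ρ S a = 1)
    (hπ : π ∈ stdSimplex ℝ E) :
    ∃ (a : ℕ → E) (p : ℕ → ℝ), ∀ k < Fintype.card E,
      p k ∈ Set.Icc (0 : ℝ) 1 ∧ a k ∈ {x | ∀ j < k, x ≠ a j} ∧
      ∑ i ∈ Finset.range k, p i * ρ {x | ∀ j < i, x ≠ a j} (a k) +
        p k * ρ {x | ∀ j < k, x ≠ a j} (a k) = π (a k) ∧
      (∀ b, ∑ i ∈ Finset.range (k + 1), p i * ρ {x | ∀ j < i, x ≠ a j} b ≤ π b) ∧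
      ∀ q ∈ Set.Icc (0 : ℝ) 1, ∀ b ∈ {x | ∀ j < k, x ≠ a j},
        ∑ i ∈ Finset.range k, p i * ρ {x | ∀ j < i, x ≠ a j} b +
          q * ρ {x | ∀ j < k, x ≠ a j} b = π b → p k ≤ q := by
  classical
  have : Nonempty E := by
    by_contra h
    rw [not_nonempty_iff] at h
    simpa using hπ.2
  -- The invariants are premises inside the existential, so that the choice is a total function; the
  -- value on bad states is arbitrary.
  have hstep : ∀ s : Set E × (E → ℝ), ∃ r : ℝ × E,
      s.1.Nonempty → (∀ a, 0 ≤ s.2 a) → (∀ a, s.2 a ≤ π a) →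
        r.1 ∈ Set.Icc (0 : ℝ) 1 ∧ r.2 ∈ s.1 ∧ s.2 r.2 + r.1 * ρ s.1 r.2 = π r.2 ∧
        (∀ a, s.2 a + r.1 * ρ s.1 a ≤ π a) ∧
        ∀ q' ∈ Set.Icc (0 : ℝ) 1, ∀ b' ∈ s.1, s.2 b' + q' * ρ s.1 b' = π b' → r.1 ≤ q' := by
    intro s
    by_cases h : s.1.Nonempty ∧ (∀ a, 0 ≤ s.2 a) ∧ ∀ a, s.2 a ≤ π a
    · obtain ⟨q, hq, b, hb, h1, h2, h3⟩ :=
        exists_minimal_filling (hρ s.1) (hρS s.1) (hρ1 s.1 h.1) hπ.2 h.2.1 h.2.2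
      exact ⟨(q, b), fun _ _ _ => ⟨hq, hb, h1, h2, h3⟩⟩
    · exact ⟨(0, Classical.arbitrary E), fun h1 h2 h3 => absurd ⟨h1, h2, h3⟩ h⟩
  choose F hF using hstep
  -- The state before round k: the set of states not yet deleted and the mass poured so far.
  let st : ℕ → Set E × (E → ℝ) := fun k => Nat.rec (Set.univ, 0)
    (fun _ s => (s.1 \ {(F s).2}, fun a => s.2 a + (F s).1 * ρ s.1 a)) k
  let a : ℕ → E := fun k => (F (st k)).2
  let p : ℕ → ℝ := fun k => (F (st k)).1
  have hst : ∀ k, st (k + 1) =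
    ((st k).1 \ {a k}, fun x => (st k).2 x + p k * ρ (st k).1 x) := fun _ => rfl
  have hset : ∀ k, (st k).1 = {x | ∀ j < k, x ≠ a j} := by
    intro k
    induction k with
    | zero => simp [st]
    | succ k ih =>
      rw [hst]
      ext x
      simp only [ih, Set.mem_sdiff, Set.mem_ofPred_eq, Set.mem_singleton_iff, Nat.lt_succ_iff_lt_or_eq]
      constructor
      · rintro ⟨h1, h2⟩ j (hj | rfl)
        exacts [h1 j hj, h2]
      · exact fun h => ⟨fun j hj => h j (Or.inl hj), h k (Or.inr rfl)⟩
  have hfun : ∀ k x, (st k).2 x = ∑ i ∈ Finset.range k, p i * ρ {x | ∀ j < i, x ≠ a j} x := by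
    intro k x
    induction k with
    | zero => simp [st]
    | succ k ih => rw [hst, Finset.sum_range_succ, ← ih, ← hset]
  have hne : ∀ k < Fintype.card E, (st k).1.Nonempty := by
    intro k hk
    have hlt : ((Finset.range k).image a).card < (Finset.univ : Finset E).card := by
      refine Finset.card_image_le.trans_lt ?_
      simpa using hk
    obtain ⟨x, -, hx⟩ := Finset.exists_mem_notMem_of_card_lt_card hlt
    refine ⟨x, ?_⟩
    rw [hset]
    intro j hj he
    exact hx (Finset.mem_image.2 ⟨j, Finset.mem_range.2 hj, he.symm⟩)
  have hinv : ∀ k ≤ Fintype.card E, (∀ x, 0 ≤ (st k).2 x) ∧ ∀ x, (st k).2 x ≤ π x := by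
    intro k
    induction k with
    | zero => exact fun _ => ⟨fun _ => le_rfl, hπ.1⟩
    | succ k ih =>
      intro hk
      obtain ⟨h1, h2⟩ := ih (by omega)
      obtain ⟨hp, -, -, hle, -⟩ := hF _ (hne k (by omega)) h1 h2
      exact ⟨fun x => add_nonneg (h1 x) (mul_nonneg hp.1 (hρ _ _)), hle⟩
  refine ⟨a, p, fun k hk => ?_⟩
  obtain ⟨h1, h2⟩ := hinv k hk.le
  obtain ⟨hp, ha, hb, -, hmin⟩ := hF _ (hne k hk) h1 h2
  change (st k).2 (a k) + p k * ρ (st k).1 (a k) = π (a k) at hb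
  change a k ∈ (st k).1 at ha
  have hle' := (hinv (k + 1) hk).2
  simp only [hfun, hset] at ha hb hle' hmin
  exact ⟨hp, ha, hb, hle', hmin⟩

/-- The filling construction as an enumeration of the finite set. -/
lemma exists_filling {ρ : Set E → E → ℝ} {π : E → ℝ} (hρ : ∀ S a, 0 ≤ ρ S a)
    (hρS : ∀ S, ∀ a ∉ S, ρ S a = 0) (hρ1 : ∀ S : Set E, S.Nonempty → ∑ a, ρ S a = 1)
    (hπ : π ∈ stdSimplex ℝ E) :
    ∃ (a : Fin (Fintype.card E) ≃ E) (p : Fin (Fintype.card E) → ℝ),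
      (∀ k, p k ∈ Set.Icc (0 : ℝ) 1) ∧
      (∀ k, ∑ i ∈ Finset.Iio k, p i * ρ (tailSet a i) (a k) +
        p k * ρ (tailSet a k) (a k) = π (a k)) ∧
      (∀ k, ∀ q ∈ Set.Icc (0 : ℝ) 1, ∀ b ∈ tailSet a k,
        ∑ i ∈ Finset.Iio k, p i * ρ (tailSet a i) b + q * ρ (tailSet a k) b = π b → p k ≤ q) ∧
      ∀ b, ∑ k, p k * ρ (tailSet a k) b = π b := by
  obtain ⟨a, p, h⟩ := exists_filling_sequence hρ hρS hρ1 hπ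
  have hinj : Function.Injective fun k : Fin (Fintype.card E) => a k := by
    intro i j hij
    by_contra hne
    rcases lt_or_gt_of_ne hne with hlt | hlt
    · exact (h j j.2).2.1 i hlt hij.symm
    · exact (h i i.2).2.1 j hlt hij
  let e : Fin (Fintype.card E) ≃ E := Equiv.ofBijective _
    ((Fintype.bijective_iff_injective_and_card _).2 ⟨hinj, by simp⟩)
  have he : ∀ k, e k = a k := fun _ => rfl
  have htail : ∀ k : Fin (Fintype.card E), tailSet e k = {x | ∀ j < (k : ℕ), x ≠ a j} := by
    intro k
    ext x
    exact ⟨fun hx j hj => hx ⟨j, hj.trans k.2⟩ hj, fun hx j hj => hx j hj⟩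
  have hsum : ∀ (k : Fin (Fintype.card E)) (f : ℕ → ℝ),
      ∑ i ∈ Finset.Iio k, f i = ∑ i ∈ Finset.range k, f i := by
    intro k f
    rw [← Nat.Iio_eq_range, ← Fin.map_valEmbedding_Iio, Finset.sum_map]
    rfl
  refine ⟨e, fun k => p k, fun k => (h k k.2).1, fun k => ?_, fun k q hq b hb => ?_, fun b => ?_⟩
  · simp only [htail, he]
    rw [hsum k fun i => p i * ρ {x | ∀ j < i, x ≠ a j} (a k)]
    exact (h k k.2).2.2.1
  · simp only [htail] at hb ⊢
    rw [hsum k fun i => p i * ρ {x | ∀ j < i, x ≠ a j} b]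
    exact (h k k.2).2.2.2.2 q hq b hb
  · obtain ⟨k, rfl⟩ := e.surjective b
    simp only [htail]
    rw [Fin.sum_univ_eq_sum_range fun i => p i * ρ {x | ∀ j < i, x ≠ a j} (e k)]
    -- The bound after the last round gives ≤. For ≥, the state chosen in round k is full after that
    -- round, and later terms are nonnegative.
    apply le_antisymm
    · have hpos : 0 < Fintype.card E := k.pos
      have hlast := (h (Fintype.card E - 1) (by omega)).2.2.2.1 (e k)
      rwa [Nat.sub_add_cancel hpos] at hlast
    · rw [he, ← (h k k.2).2.2.1, ← Finset.sum_range_succ]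
      refine Finset.sum_le_sum_of_subset_of_nonneg
        (Finset.range_subset_range.2 (Nat.succ_le_of_lt k.2)) fun i hi _ => ?_
      exact mul_nonneg (h i (Finset.mem_range.1 hi)).1.1 (hρ _ _)

/-- The mass of the rates of the tail sets of `π`-mass less than `ε` is at most `ε`. -/
lemma sum_rate_small_tail_le {ρ : Set E → E → ℝ} {π : E → ℝ} {n : ℕ} {a : Fin n ≃ E}
    {p : Fin n → ℝ} [∀ k, DecidablePred (· ∈ tailSet a k)] (hρ : ∀ S a, 0 ≤ ρ S a)
    (hρS : ∀ S, ∀ a ∉ S, ρ S a = 0) (hρ1 : ∀ S : Set E, S.Nonempty → ∑ a, ρ S a = 1)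
    (hp : ∀ k, 0 ≤ p k) (hbal : ∀ b, ∑ k, p k * ρ (tailSet a k) b = π b) {ε : ℝ} (hε : 0 ≤ ε) :
    ∑ k with ∑ x with x ∈ tailSet a k, π x < ε, p k ≤ ε := by
  set I := Finset.univ.filter fun k => ∑ x with x ∈ tailSet a k, π x < ε with hI
  rcases I.eq_empty_or_nonempty with h | h
  · simpa [h] using hε
  have hm := I.min'_mem h
  -- The first light index: its tail set contains the tail sets of all other light indices, so their
  -- harmonic measures have full mass on it.
  set m := I.min' h with hmdef
  refine le_trans ?_ (Finset.mem_filter.1 hm).2.le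
  calc ∑ k ∈ I, p k = ∑ k ∈ I, ∑ x with x ∈ tailSet a m, p k * ρ (tailSet a k) x := by
        refine Finset.sum_congr rfl fun k hk => ?_
        have hne : (tailSet a k).Nonempty := ⟨a k, fun j hj he => hj.ne' (a.injective he)⟩
        have hsub : ∑ x with x ∈ tailSet a m, ρ (tailSet a k) x = 1 := by
          rw [← hρ1 _ hne, Finset.sum_filter]
          refine Finset.sum_congr rfl fun x _ => ?_
          split_ifs with hx
          · rfl
          · refine (hρS _ x fun hx' => hx fun j hj => ?_).symm
            exact hx' j (hj.trans_le (I.min'_le k hk))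
        rw [← Finset.mul_sum, hsub, mul_one]
    _ ≤ ∑ k, ∑ x with x ∈ tailSet a m, p k * ρ (tailSet a k) x :=
        Finset.sum_le_sum_of_subset_of_nonneg (Finset.subset_univ _) fun k _ _ =>
          Finset.sum_nonneg fun x _ => mul_nonneg (hp k) (hρ _ _)
    _ = ∑ x with x ∈ tailSet a m, π x := by
        rw [Finset.sum_comm]
        exact Finset.sum_congr rfl fun x _ => hbal x

end Selection

/-! ### Positivity of the transition matrix -/

section Positivity

variable {E : Type*} [Fintype E] [DecidableEq E] {Q : Matrix E E ℝ}

lemma matrix_pow_nonneg {B : Matrix E E ℝ} (hB : ∀ x y, 0 ≤ B x y) (n : ℕ) (x y : E) :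
    0 ≤ (B ^ n) x y := by
  induction n generalizing y with
  | zero => rw [pow_zero, Matrix.one_apply]; split_ifs <;> norm_num
  | succ n ih =>
    rw [pow_succ, Matrix.mul_apply]
    exact Finset.sum_nonneg fun z _ => mul_nonneg (ih z) (hB z y)

lemma hasSum_exp_matrix_apply (B : Matrix E E ℝ) (x y : E) :
    HasSum (fun n : ℕ => (n.factorial : ℝ)⁻¹ * (B ^ n) x y) (NormedSpace.exp B x y) := by
  have h : HasSum (fun n : ℕ => (n.factorial⁻¹ : ℝ) • B ^ n) (NormedSpace.exp B) := by
    let : NormedRing (Matrix E E ℝ) := Matrix.linftyOpNormedRing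
    let : NormedAlgebra ℝ (Matrix E E ℝ) := Matrix.linftyOpNormedAlgebra
    exact NormedSpace.exp_series_hasSum_exp' B
  have h2 := (Pi.hasSum.1 (Pi.hasSum.1 h x)) y
  simpa using h2

lemma exp_matrix_nonneg {B : Matrix E E ℝ} (hB : ∀ x y, 0 ≤ B x y) (x y : E) :
    0 ≤ NormedSpace.exp B x y :=
  (hasSum_exp_matrix_apply B x y).nonneg fun n =>
    mul_nonneg (by positivity) (matrix_pow_nonneg hB n x y)

/-- Uniformization: a shift of the diagonal factors out of the matrix exponential. -/
lemma exp_matrix_eq_smul (A : Matrix E E ℝ) (c : ℝ) (x y : E) :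
    NormedSpace.exp A x y = Real.exp (-c) * NormedSpace.exp (A + c • (1 : Matrix E E ℝ)) x y := by
  have h : A = (-c) • (1 : Matrix E E ℝ) + (A + c • (1 : Matrix E E ℝ)) := by
    rw [neg_smul]; abel
  have hc : Commute ((-c) • (1 : Matrix E E ℝ)) (A + c • (1 : Matrix E E ℝ)) :=
    (Commute.one_left _).smul_left _
  have hd : NormedSpace.exp ((-c) • (1 : Matrix E E ℝ)) =
      Matrix.diagonal fun _ => Real.exp (-c) := by
    rw [Matrix.smul_one_eq_diagonal, Matrix.exp_diagonal]
    rw [Pi.exp_def, Real.exp_eq_exp_ℝ]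
  conv_lhs => rw [h]
  rw [Matrix.exp_add_of_commute _ _ hc, hd, Matrix.diagonal_mul]

lemma IsGenerator.exists_shift_nonneg (hQ : IsGenerator Q) :
    ∃ c : ℝ, ∀ x y, 0 ≤ (Q + c • (1 : Matrix E E ℝ)) x y := by
  refine ⟨∑ x, |Q x x|, fun x y => ?_⟩
  rw [Matrix.add_apply, Matrix.smul_apply, Matrix.one_apply]
  split_ifs with h
  · subst h
    have := Finset.single_le_sum (f := fun z => |Q z z|) (fun z _ => abs_nonneg _)
      (Finset.mem_univ x)
    have h2 := neg_abs_le (Q x x)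
    simp only [smul_eq_mul, mul_one]
    linarith
  · simpa using hQ.rate_nonneg x y h

lemma IsGenerator.transition_nonneg (hQ : IsGenerator Q) (t : ℝ≥0) (x y : E) :
    0 ≤ transition Q t x y := by
  obtain ⟨c, hc⟩ := hQ.exists_shift_nonneg
  -- The shift t c turns t Q into t (Q + c I), which has nonnegative entries.
  rw [transition, exp_matrix_eq_smul _ ((t : ℝ) * c), mul_smul, ← smul_add]
  exact mul_nonneg (Real.exp_nonneg _)
    (exp_matrix_nonneg (fun x y => mul_nonneg t.2 (hc x y)) x y)

/-- A path of n jumps of positive rate from x to y makes the (x, y) entry of (Q + c I)^n positive,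
and a single positive term suffices in the nonnegative exponential series. -/
lemma IrreducibleGenerator.transition_one_pos (hQ : IsGenerator Q) (hirr : IrreducibleGenerator Q)
    (x y : E) : 0 < transition Q 1 x y := by
  obtain ⟨c, hc⟩ := hQ.exists_shift_nonneg
  rw [transition, NNReal.coe_one, one_smul, exp_matrix_eq_smul _ c]
  set B := Q + c • (1 : Matrix E E ℝ) with hB
  have hpow : ∃ n, 0 < (B ^ n) x y := by
    induction hirr x y with
    | refl => exact ⟨0, by simp⟩
    | @tail y z _ hyz ih =>
      obtain ⟨n, hn⟩ := ih
      refine ⟨n + 1, ?_⟩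
      rw [pow_succ, Matrix.mul_apply]
      refine Finset.sum_pos' (fun w _ => mul_nonneg (matrix_pow_nonneg hc n x w) (hc w z))
        ⟨y, Finset.mem_univ y, mul_pos hn ?_⟩
      simpa [hB, Matrix.one_apply, hyz.1] using hyz.2
  obtain ⟨n, hn⟩ := hpow
  refine mul_pos (Real.exp_pos _) ?_
  have h := hasSum_exp_matrix_apply B x y
  rw [← h.tsum_eq]
  exact h.summable.tsum_pos (fun m => mul_nonneg (by positivity) (matrix_pow_nonneg hc m x y)) n
    (mul_pos (by positivity) hn)

end Positivity

/-! ### Almost sure hitting and Markov's inequality -/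

section AlmostSureHitting

variable {E Ω : Type*} [Fintype E] [DecidableEq E] [MeasurableSpace E] [MeasurableSingletonClass E]
  [MeasurableSpace Ω] {Q : Matrix E E ℝ} {X : ℝ≥0 → Ω → E} {law : E → Measure Ω}

omit [MeasurableSingletonClass E] in
lemma IsMarkovChain.law_eq_transition (hX : IsMarkovChain Q X law) (x : E) (t : ℝ≥0) (y : E) :
    law x {ω | X t ω = y} = ENNReal.ofReal (transition Q t x y) := by
  have h := hX.finiteDimensional x 0 (fun _ => t) monotone_const (fun _ => y)
  simpa using h

omit [MeasurableSingletonClass E] in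
lemma IsMarkovChain.law_path_succ (hQ : IsGenerator Q) (hX : IsMarkovChain Q X law) (x : E) (m : ℕ)
    (y : Fin (m + 1) → E) (z : E) :
    law x {ω | ∀ i : Fin (m + 2), X (i : ℕ) ω = (Fin.snoc y z : Fin (m + 2) → E) i} =
      law x {ω | ∀ i : Fin (m + 1), X (i : ℕ) ω = y i} *
        ENNReal.ofReal (transition Q 1 (y (Fin.last m)) z) := by
  have hmono : ∀ k, Monotone fun i : Fin (k + 1) => ((i : ℕ) : ℝ≥0) :=
    fun k i j hij => Nat.cast_le.2 (Fin.le_def.1 hij)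
  have hstep : ∀ k : ℕ, ((k + 1 : ℕ) : ℝ≥0) - (k : ℝ≥0) = 1 := fun k => by
    push_cast; exact add_tsub_cancel_left _ _
  rw [hX.finiteDimensional x (m + 1) _ (hmono _), hX.finiteDimensional x m _ (hmono _),
    ← ENNReal.ofReal_mul, Fin.prod_univ_castSucc, ← mul_assoc]
  · congr 2
    · refine congrArg₂ _ ?_ ?_
      · exact congrArg _ (Fin.snoc_castSucc (α := fun _ => E) z y 0)
      · refine Finset.prod_congr rfl fun i _ => ?_
        have h1 := Fin.snoc_castSucc (α := fun _ => E) z y i.castSucc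
        have h2 := Fin.snoc_castSucc (α := fun _ => E) z y i.succ
        rw [← Fin.succ_castSucc] at h2
        simp only [h1, h2, Fin.val_succ, Fin.val_castSucc, hstep]
    · have h1 := Fin.snoc_castSucc (α := fun _ => E) z y (Fin.last m)
      have h2 := Fin.snoc_last (α := fun _ => E) z y
      rw [← Fin.succ_last] at h2
      simp only [h1, h2, Fin.val_succ, Fin.val_castSucc, hstep]
  · exact mul_nonneg (hQ.transition_nonneg _ _ _)
      (Finset.prod_nonneg fun i _ => hQ.transition_nonneg _ _ _)

lemma IsMarkovChain.law_avoid_eq_sum (hX : IsMarkovChain Q X law) (x : E) (m : ℕ) (S : Finset E) :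
    law x {ω | ∀ i : Fin (m + 1), X (i : ℕ) ω ∈ S} =
      ∑ y ∈ Fintype.piFinset fun _ : Fin (m + 1) => S,
        law x {ω | ∀ i : Fin (m + 1), X (i : ℕ) ω = y i} := by
  rw [← measure_biUnion_finset]
  · congr 1
    ext ω
    simp only [Set.mem_ofPred_eq, Set.mem_iUnion, Fintype.mem_piFinset, exists_prop]
    constructor
    · exact fun h => ⟨fun i => X (i : ℕ) ω, h, fun _ => rfl⟩
    · rintro ⟨y, hy, he⟩ i
      rw [he i]
      exact hy i
  · intro y _ y' _ hne
    refine Set.disjoint_left.2 fun ω h h' => hne (funext fun i => ?_)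
    rw [← h i, h' i]
  · intro y _
    have : {ω | ∀ i : Fin (m + 1), X (i : ℕ) ω = y i} =
        ⋂ i : Fin (m + 1), X (i : ℕ) ⁻¹' {y i} := by ext; simp
    rw [this]
    exact .iInter fun i => hX.measurable _ (measurableSet_singleton _)

/-- Split off the last integer time: wherever the path then stands, staying in S for one more step
costs a factor r. There are m + 1 times but only m steps, hence the exponent m. -/
lemma IsMarkovChain.law_avoid_le (hQ : IsGenerator Q) (hX : IsMarkovChain Q X law) (x : E)
    {S : Finset E} {r : ℝ≥0∞} (hr : ∀ y, ∑ z ∈ S, ENNReal.ofReal (transition Q 1 y z) ≤ r) (m : ℕ) :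
    law x {ω | ∀ i : Fin (m + 1), X (i : ℕ) ω ∈ S} ≤ r ^ m := by
  have := hX.isProbabilityMeasure x
  induction m with
  | zero => simpa using prob_le_one
  | succ m ih =>
    calc law x {ω | ∀ i : Fin (m + 2), X (i : ℕ) ω ∈ S}
        = ∑ y ∈ Fintype.piFinset fun _ : Fin (m + 2) => S,
          law x {ω | ∀ i : Fin (m + 2), X (i : ℕ) ω = y i} := hX.law_avoid_eq_sum x _ S
      _ = ∑ w ∈ S ×ˢ Fintype.piFinset fun _ : Fin (m + 1) => S,
          law x {ω | ∀ i : Fin (m + 2),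
            X (i : ℕ) ω = (Fin.snoc w.2 w.1 : Fin (m + 2) → E) i} := by
        symm
        refine Finset.sum_equiv (Fin.snocEquiv fun _ => E) (fun w => ?_) fun w _ => rfl
        simp [Fin.forall_fin_succ', Fin.snocEquiv, and_comm]
      _ = ∑ y ∈ Fintype.piFinset fun _ : Fin (m + 1) => S,
          law x {ω | ∀ i : Fin (m + 1), X (i : ℕ) ω = y i} *
            ∑ z ∈ S, ENNReal.ofReal (transition Q 1 (y (Fin.last m)) z) := by
        rw [Finset.sum_product_right]
        refine Finset.sum_congr rfl fun y _ => ?_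
        rw [Finset.mul_sum]
        exact Finset.sum_congr rfl fun z _ => hX.law_path_succ hQ x m y z
      _ ≤ ∑ y ∈ Fintype.piFinset fun _ : Fin (m + 1) => S,
          law x {ω | ∀ i : Fin (m + 1), X (i : ℕ) ω = y i} * r :=
        Finset.sum_le_sum fun y _ => mul_le_mul_right (hr _) _
      _ ≤ r ^ (m + 1) := by
        rw [← Finset.sum_mul, ← hX.law_avoid_eq_sum, pow_succ]
        exact mul_le_mul_left ih r

lemma IsMarkovChain.sum_transition_compl_lt_one (hQ : IsGenerator Q)
    (hirr : IrreducibleGenerator Q) (hX : IsMarkovChain Q X law) (b y : E) :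
    ∑ z ∈ Finset.univ.erase b, ENNReal.ofReal (transition Q 1 y z) < 1 := by
  have := hX.isProbabilityMeasure y
  have h1 : ∑ z, ENNReal.ofReal (transition Q 1 y z) = 1 := by
    rw [← measure_univ (μ := law y)]
    simp_rw [← hX.law_eq_transition]
    have h := sum_measure_preimage_singleton (μ := law y) (f := X 1) Finset.univ
      fun z _ => hX.measurable 1 (measurableSet_singleton z)
    simpa using! h
  rw [← h1, ← Finset.sum_erase_add _ _ (Finset.mem_univ b)]
  refine ENNReal.lt_add_right ?_ ?_
  · exact ENNReal.sum_ne_top.2 fun _ _ => ENNReal.ofReal_ne_top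
  · exact (ENNReal.ofReal_pos.2 (hirr.transition_one_pos hQ y b)).ne'

/-- An irreducible chain almost surely hits every nonempty set. -/
lemma IsMarkovChain.ae_hitTime_ne_top (hQ : IsGenerator Q) (hirr : IrreducibleGenerator Q)
    (hX : IsMarkovChain Q X law) (x : E) {A : Set E} (hA : A.Nonempty) :
    ∀ᵐ ω ∂law x, hitTime X A ω ≠ ∞ := by
  obtain ⟨b, hb⟩ := hA
  -- The worst probability of missing b one unit of time later. A path that never hits A misses b at
  -- all integer times, so this event has probability at most r ^ m for every m.
  set r := Finset.univ.sup fun y =>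
    ∑ z ∈ Finset.univ.erase b, ENNReal.ofReal (transition Q 1 y z) with hr
  have hr1 : r < 1 := (Finset.sup_lt_iff (by simp)).2 fun y _ =>
    hX.sum_transition_compl_lt_one hQ hirr b y
  have hle : ∀ m : ℕ, law x {ω | ¬ hitTime X A ω ≠ ∞} ≤ r ^ m := fun m => by
    refine (measure_mono fun ω hω i => ?_).trans
      (hX.law_avoid_le hQ x (fun y => Finset.le_sup (f := fun y =>
        ∑ z ∈ Finset.univ.erase b, ENNReal.ofReal (transition Q 1 y z)) (Finset.mem_univ y)) m)
    have h := hitTime_eq_top_iff.1 (not_not.1 hω) (i : ℕ)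
    refine Finset.mem_erase.2 ⟨fun he => h (he ▸ hb), Finset.mem_univ _⟩
  exact le_antisymm (ge_of_tendsto' (ENNReal.tendsto_pow_atTop_nhds_zero_of_lt_one hr1) hle)
    (by simp)

omit [MeasurableSingletonClass E] in
lemma isProbabilityMeasure_startedFrom (hX : IsMarkovChain Q X law) {μ : E → ℝ}
    (hμ : μ ∈ stdSimplex ℝ E) : IsProbabilityMeasure (startedFrom law μ) := by
  have := hX.isProbabilityMeasure
  refine ⟨?_⟩
  simp only [startedFrom, Measure.coe_finsetSum, Measure.coe_smul, Finset.sum_apply, Pi.smul_apply,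
    measure_univ, smul_eq_mul, mul_one]
  rw [← ENNReal.ofReal_sum_of_nonneg fun x _ => hμ.1 x, hμ.2, ENNReal.ofReal_one]

lemma IsMarkovChain.ae_startedFrom_hitTime_ne_top (hQ : IsGenerator Q)
    (hirr : IrreducibleGenerator Q) (hX : IsMarkovChain Q X law) (μ : E → ℝ) {A : Set E}
    (hA : A.Nonempty) : ∀ᵐ ω ∂startedFrom law μ, hitTime X A ω ≠ ∞ := by
  rw [ae_iff]
  simp only [startedFrom, Measure.coe_finsetSum, Measure.coe_smul, Finset.sum_apply, Pi.smul_apply]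
  refine Finset.sum_eq_zero fun x _ => ?_
  rw [ae_iff.1 (hX.ae_hitTime_ne_top hQ hirr x hA), smul_zero]

/-- Markov's inequality for the hitting time of a set of large `π`-mass. -/
lemma IsMarkovChain.startedFrom_hitTime_gt_le (hX : IsMarkovChain Q X law) {μ π : E → ℝ}
    (hμ : μ ∈ stdSimplex ℝ E) {A : Finset E} (hA : A.Nonempty) {ε : ℝ} (hε : ε ≤ ∑ a ∈ A, π a)
    {t : ℝ≥0} (ht : 0 < t) :
    startedFrom law μ {ω | (t : ℝ≥0∞) < hitTime X (A : Set E) ω} ≤ tHit X law π ε / t := by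
  have hm := measurable_hitTime hX.rightContinuous hX.measurable
    (Set.toFinite (A : Set E)).measurableSet
  have hone : ∀ x, law x {ω | (t : ℝ≥0∞) < hitTime X (A : Set E) ω} ≤ tHit X law π ε / t := by
    intro x
    calc law x {ω | (t : ℝ≥0∞) < hitTime X (A : Set E) ω}
        ≤ law x {ω | (t : ℝ≥0∞) ≤ hitTime X (A : Set E) ω} :=
          measure_mono fun ω (h : (t : ℝ≥0∞) < _) => h.le
      _ ≤ (∫⁻ ω, hitTime X (A : Set E) ω ∂law x) / t :=
          meas_ge_le_lintegral_div hm.aemeasurable (by simpa using ht.ne') ENNReal.coe_ne_top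
      _ ≤ tHit X law π ε / t := by
          gcongr
          exact le_iSup_of_le x (le_iSup_of_le A (le_iSup₂_of_le hA hε le_rfl))
  simp only [startedFrom, Measure.coe_finsetSum, Measure.coe_smul, Finset.sum_apply, Pi.smul_apply,
    smul_eq_mul]
  calc ∑ x, ENNReal.ofReal (μ x) * law x {ω | (t : ℝ≥0∞) < hitTime X (A : Set E) ω}
      ≤ ∑ x, ENNReal.ofReal (μ x) * (tHit X law π ε / t) :=
        Finset.sum_le_sum fun x _ => mul_le_mul_right (hone x) _
    _ = tHit X law π ε / t := by
        rw [← Finset.sum_mul, ← ENNReal.ofReal_sum_of_nonneg fun x _ => hμ.1 x, hμ.2,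
          ENNReal.ofReal_one, one_mul]

end AlmostSureHitting

/-! ### Randomization by an independent uniform variable -/

lemma exists_measurable_index {n : ℕ} {p : Fin n → ℝ} (hp : ∀ k, 0 ≤ p k) (hp1 : ∑ k, p k = 1) :
    ∃ K : unitInterval → Fin n, Measurable K ∧
      ∀ k, (volume : Measure unitInterval) {u | K u = k} = ENNReal.ofReal (p k) := by
  have hsum : ∑ k, ENNReal.ofReal (p k) = 1 := by
    rw [← ENNReal.ofReal_sum_of_nonneg fun k _ => hp k, hp1, ENNReal.ofReal_one]
  have hne : Nonempty (Fin n) := by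
    by_contra h
    rw [not_nonempty_iff] at h
    simp at hp1
  obtain ⟨K, hK, hmap⟩ :=
    (PMF.ofFintype (fun k => ENNReal.ofReal (p k)) hsum).toMeasure.exists_measurable_map_eq
  refine ⟨K, hK, fun k => ?_⟩
  have h := congrArg (fun ν => ν {k}) hmap
  simp only [Measure.map_apply hK (measurableSet_singleton k),
    PMF.toMeasure_apply_singleton _ _ (measurableSet_singleton k), PMF.ofFintype_apply] at h
  exact h

section RandomSet

variable {E Ω : Type*} [MeasurableSpace E] [MeasurableSpace Ω] {X : ℝ≥0 → Ω → E} {P : Measure Ω}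
  {n : ℕ} {A : Fin n → Set E} {K : unitInterval → Fin n} {p : Fin n → ℝ}

/-- Events that depend on the chain and on the random index split over the value of the index. -/
lemma prod_volume_random_index [SFinite P] (hK : Measurable K)
    (hp : ∀ k, (volume : Measure unitInterval) {u | K u = k} = ENNReal.ofReal (p k))
    {B : Fin n → Set Ω} (hB : ∀ k, MeasurableSet (B k)) :
    (P.prod (volume : Measure unitInterval)) {z | z.1 ∈ B (K z.2)} =
      ∑ k, ENNReal.ofReal (p k) * P (B k) := by
  have h : {z : Ω × unitInterval | z.1 ∈ B (K z.2)} =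
      ⋃ k ∈ (Finset.univ : Finset (Fin n)), B k ×ˢ {u | K u = k} := by
    ext z
    simp
  rw [h, measure_biUnion_finset]
  · refine Finset.sum_congr rfl fun k _ => ?_
    rw [Measure.prod_prod, hp, mul_comm]
  · intro i _ j _ hij
    refine Set.disjoint_left.2 fun z hi hj => hij ?_
    exact (hi.2 : K z.2 = i).symm.trans hj.2
  · exact fun k _ => (hB k).prod (hK (measurableSet_singleton k))

/-- The index is known from time 0, being a function of U; once it is fixed, H ≤ t is decided by
countably many times up to t. -/
lemma isStoppingTime_random_hitTime (hr : HasRightContinuousPaths X) (hm : ∀ t, Measurable (X t))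
    (hA : ∀ k, MeasurableSet (A k)) (hK : Measurable K) :
    IsStoppingTime (randomizedHistory X hm)
      (fun z : Ω × unitInterval => hitTime X (A (K z.2)) z.1) := by
  intro t
  have hXt : ∀ s ≤ t, ∀ k, MeasurableSet[randomizedHistory X hm t]
      {z : Ω × unitInterval | X s z.1 ∈ A k} := fun s hs k => by
    have hle : MeasurableSpace.comap (fun z : Ω × unitInterval => X s z.1) inferInstance ≤
        randomizedHistory X hm t :=
      (le_iSup₂_of_le (f := fun s (_ : s ≤ t) => MeasurableSpace.comap
        (fun z : Ω × unitInterval => X s z.1) inferInstance) s hs le_rfl).trans le_sup_left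
    exact hle _ ⟨A k, hA k, rfl⟩
  have hU : ∀ k, MeasurableSet[randomizedHistory X hm t] {z : Ω × unitInterval | K z.2 = k} :=
    fun k => by
      have hle : MeasurableSpace.comap (fun z : Ω × unitInterval => z.2) inferInstance ≤
        randomizedHistory X hm t := le_sup_right
      exact hle _ ⟨K ⁻¹' {k}, hK (measurableSet_singleton k), rfl⟩
  have h : {z : Ω × unitInterval | hitTime X (A (K z.2)) z.1 ≤ t} =
      ⋃ k, {z | K z.2 = k} ∩ ({z | X t z.1 ∈ A k} ∪
        ⋃ (i : ℕ) (_ : TopologicalSpace.denseSeq ℝ≥0 i ≤ t),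
          {z | X (TopologicalSpace.denseSeq ℝ≥0 i) z.1 ∈ A k}) := by
    ext z
    have hz := Set.ext_iff.1 (setOf_hitTime_le_eq (A := A (K z.2)) (t := t) hr) z.1
    simpa using! hz
  change MeasurableSet[randomizedHistory X hm t]
    {z : Ω × unitInterval | hitTime X (A (K z.2)) z.1 ≤ t}
  rw [h]
  exact .iUnion fun k => (hU k).inter ((hXt t le_rfl k).union
    (.iUnion fun i => .iUnion fun hi => hXt _ hi k))

end RandomSet

/-! ### The randomized hitting time -/

theorem lemma1 {E Ω : Type*} [Fintype E] [DecidableEq E] [MeasurableSpace E]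
    [MeasurableSingletonClass E] [MeasurableSpace Ω]
    (Q : Matrix E E ℝ) (hQ : IsGenerator Q) (hirr : IrreducibleGenerator Q)
    (π : E → ℝ) (hπ : IsStationaryDistribution Q π)
    (X : ℝ≥0 → Ω → E) (law : E → Measure Ω) (hX : IsMarkovChain Q X law)
    (μ₀ : E → ℝ) (hμ₀ : μ₀ ∈ stdSimplex ℝ E) :
    ∃ T : Ω × unitInterval → ℝ≥0∞,
      -- `T` is a randomized stopping time with `X_T ∼ π` and the stated tail bound
      IsRandomizedStoppingTime X hX.measurable (startedFrom law μ₀) T ∧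
      (∀ y, ((startedFrom law μ₀).prod (volume : Measure unitInterval))
          {z | ∃ s : ℝ≥0, T z = s ∧ X s z.1 = y} = ENNReal.ofReal (π y)) ∧
      (∀ ε ∈ Set.Ioo (0 : ℝ) 1, ∀ t : ℝ≥0, 0 < t →
        ((startedFrom law μ₀).prod (volume : Measure unitInterval)) {z | (t : ℝ≥0∞) < T z} ≤
          ENNReal.ofReal ε + tHit X law π ε / t) ∧
      -- `T = H_A`, where `A` is a function of `U` alone and equals `A_k` with probability `p_k`
      ∃ (a : Fin (Fintype.card E) ≃ E) (p : Fin (Fintype.card E) → ℝ)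
        (K : unitInterval → Fin (Fintype.card E)),
        IsInductiveChoice X (startedFrom law μ₀) π a p ∧
        ∑ k, p k = 1 ∧
        Measurable K ∧
        (∀ k, (volume : Measure unitInterval) {u | K u = k} = ENNReal.ofReal (p k)) ∧
        ∀ ω u, T (ω, u) = hitTime X (tailSet a (K u)) ω := by
  classical
  have hr : HasRightContinuousPaths X := hX.rightContinuous
  have hm := hX.measurable
  have hP := isProbabilityMeasure_startedFrom hX hμ₀
  set P := startedFrom law μ₀ with hPdef
  have hmeas : ∀ A : Set E, MeasurableSet A := fun A => (Set.toFinite A).measurableSet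
  have hfin : ∀ A : Set E, A.Nonempty → ∀ᵐ ω ∂P, hitTime X A ω ≠ ∞ := fun A hA =>
    hX.ae_startedFrom_hitTime_ne_top hQ hirr μ₀ hA
  have hρ : ∀ S a, 0 ≤ harmonicMeasure X P S a := fun S a => harmonicMeasure_nonneg a
  have hρS : ∀ S, ∀ a ∉ S, harmonicMeasure X P S a = 0 := fun S a => harmonicMeasure_eq_zero hr
  have hρ1 : ∀ S : Set E, S.Nonempty → ∑ a, harmonicMeasure X P S a = 1 := fun S hS =>
    sum_harmonicMeasure_eq_one hr hm (hfin S hS)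
  obtain ⟨a, p, hp, hbal, hmin, hfill⟩ := exists_filling hρ hρS hρ1 hπ.mem_simplex
  have hne : ∀ k, (tailSet a k).Nonempty := fun k =>
    ⟨a k, fun j hj he => hj.ne' (a.injective he)⟩
  have hp1 : ∑ k, p k = 1 := by
    -- Sum the filling identity over all states: each harmonic measure contributes mass one.
    rw [← hπ.mem_simplex.2, ← Finset.sum_congr rfl fun b _ => hfill b, Finset.sum_comm]
    exact Finset.sum_congr rfl fun k _ => by rw [← Finset.mul_sum, hρ1 _ (hne k), mul_one]
  obtain ⟨K, hK, hKp⟩ := exists_measurable_index (fun k => (hp k).1) hp1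
  refine ⟨fun z => hitTime X (tailSet a (K z.2)) z.1,
    ⟨isStoppingTime_random_hitTime hr hm (fun k => hmeas _) hK, ?_⟩, fun y => ?_,
    fun ε hε t ht => ?_, a, p, K, ⟨hp, hbal, hmin⟩, hp1, hK, hKp, fun _ _ => rfl⟩
  · have h : ∀ᵐ ω ∂P, ∀ k, hitTime X (tailSet a k) ω ≠ ∞ :=
      ae_all_iff.2 fun k => hfin _ (hne k)
    filter_upwards [Measure.quasiMeasurePreserving_fst.ae h] with z hz using hz _
  · rw [← hfill y, ENNReal.ofReal_sum_of_nonneg fun k _ => mul_nonneg (hp k).1 (hρ _ _)]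
    refine (prod_volume_random_index hK hKp
      (B := fun k => {ω | ∃ s : ℝ≥0, hitTime X (tailSet a k) ω = s ∧ X s ω = y})
      fun k => measurableSet_hitTime_eq_and_eq hr hm (hmeas _) y).trans ?_
    refine Finset.sum_congr rfl fun k _ => ?_
    rw [ENNReal.ofReal_mul (hp k).1, harmonicMeasure, ofReal_measureReal]
  · refine (prod_volume_random_index hK hKp
      (B := fun k => {ω | (t : ℝ≥0∞) < hitTime X (tailSet a k) ω})
      fun k => measurableSet_lt measurable_const (measurable_hitTime hr hm (hmeas _))).trans_le ?_
    -- Light tail sets contribute at most their total rate, which is at most ε; the others obey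
    -- Markov's inequality with weights summing to at most 1.
    rw [← Finset.sum_filter_add_sum_filter_not Finset.univ
      (fun k => ∑ x with x ∈ tailSet a k, π x < ε)]
    refine add_le_add ?_ ?_
    · refine (Finset.sum_le_sum fun k _ => mul_le_of_le_one_right' prob_le_one).trans ?_
      rw [← ENNReal.ofReal_sum_of_nonneg fun k _ => (hp k).1]
      exact ENNReal.ofReal_le_ofReal
        (sum_rate_small_tail_le hρ hρS hρ1 (fun k => (hp k).1) hfill hε.1.le)
    · calc _ ≤ ∑ k with ¬ ∑ x with x ∈ tailSet a k, π x < ε,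
            ENNReal.ofReal (p k) * (tHit X law π ε / t) := by
            refine Finset.sum_le_sum fun k hk => mul_le_mul_right ?_ _
            have h := hX.startedFrom_hitTime_gt_le hμ₀
              (A := Finset.univ.filter (· ∈ tailSet a k))
              ((hne k).imp fun x hx => by simpa using hx)
              (not_lt.1 (Finset.mem_filter.1 hk).2) ht
            simpa using h
        _ ≤ ∑ k, ENNReal.ofReal (p k) * (tHit X law π ε / t) :=
            Finset.sum_le_sum_of_subset (Finset.subset_univ _)
        _ = tHit X law π ε / t := by
            rw [← Finset.sum_mul, ← ENNReal.ofReal_sum_of_nonneg fun k _ => (hp k).1, hp1,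
              ENNReal.ofReal_one, one_mul]
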